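/- Let $C_b^\infty(\mathbb R)$ be the space of $C^\infty$-functions $g:\mathbb R\to\mathbb C$ all of whose derivatives $g^{(k)}$, $k\ge 0$, are bounded. For $g\in C_b^\infty(\mathbb R)$ let $Sg=f$ be the unique $C^\infty$-function $f:\mathbb R\to\mathbb C$ with $$g(t)=\frac1{2\pi}\int_{-2}^{2}g(s)\sqrt{4-s^2}\,ds+(t^2-4)f'(t)+3t f(t)\qquad(t\in\mathbb R),$$ and let $Tg=(Sg)'''$; then $T$ maps $C_b^\infty(\mathbb R)$ linearly into itself. For $j,k\ge 0$ and $g\in C_b^\infty(\mathbb R)$ put $$\alpha_j(g)=\frac1{2\pi}\int_{-2}^{2}[T^jg](t)\sqrt{4-t^2}\,dt,\qquad E_k(g)=\frac1\pi\int_{-2}^{2}g^{(k)}(x)\,\frac{T_k(x/2)}{\sqrt{4-x^2}}\,dx,$$ where $T_k$ is the Chebyshev polynomial of the first kind, $T_k(\cos\theta)=\cos(k\theta)$. Let the constants $C_{j,r}$ ($j\ge1$, $2j\le r\le 3j-1$) be given by $C_{1,2}=1$ and, for $j\ge 1$, $$C_{j+1,r}=\frac{(2r-3)(2r-1)}{r+1}\Big((r-1)C_{j,r-2}+(4r-10)C_{j,r-3}\Big)\qquad(2j+2\le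 r\le 3j+2),$$ with the convention $C_{j,2j-1}=0=C_{j,3j}$. Then for every $j\ge1$ and every $g\in C_b^\infty(\mathbb R)$, $$\alpha_j(g)=\sum_{k=2j}^{3j-1}C_{j,k}\,\frac{k!}{(2k)!}\,E_k(g).$$ In particular, the restriction of $\alpha_j$ to $C_c^\infty(\mathbb R)$ is a distribution on $\mathbb R$; it is supported on $[-2,2]$, i.e. $\alpha_j(\varphi)=0$ for every $\varphi\in C_c^\infty(\mathbb R)$ with $\operatorname{supp}\varphi\cap[-2,2]=\emptyset$; and it has order at most $3j-1$, i.e. for every compact $K\subset\mathbb R$ there is a constant $c$ such that $|\alpha_j(\varphi)|\le c\,\max_{0\le i\le 3j-1}\sup_{x}|\varphi^{(i)}(x)|$ for all $\varphi\in C_c^\infty(\mathbb R)$ with $\operatorname{supp}\varphi\subseteq K$. -/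

import Mathlib

open scoped ContDiff Distributions

noncomputable section

namespace GUE

/-- Membership in `C_b^∞(ℝ)`: smooth functions `ℝ → ℂ` all of whose derivatives are bounded. -/
def IsCbInfty (g : ℝ → ℂ) : Prop :=
  ContDiff ℝ ∞ g ∧ ∀ k : ℕ, ∃ M : ℝ, ∀ t : ℝ, ‖iteratedDeriv k g t‖ ≤ M

/-- The mean `(1/2π) ∫_{-2}^{2} g(t) √(4 - t²) dt` of `g` for the semicircle law. -/
def semicircleMean (g : ℝ → ℂ) : ℂ :=
  (1 / (2 * (Real.pi : ℂ))) * ∫ t in (-2 : ℝ)..2, g t * (Real.sqrt (4 - t ^ 2) : ℂ)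

/-- `f` is a smooth solution on `ℝ` of
`g(t) = (1/2π) ∫_{-2}^{2} g(s) √(4 - s²) ds + (t² - 4) f'(t) + 3 t f(t)`. -/
def IsSolution (g f : ℝ → ℂ) : Prop :=
  ContDiff ℝ ∞ f ∧
    ∀ t : ℝ, g t = semicircleMean g + ((t : ℂ) ^ 2 - 4) * deriv f t + 3 * (t : ℂ) * f t

/-- `S g` is the smooth solution `f` of the equation above; for smooth `g` it exists and is unique
(so that the choice made here is no choice). -/
def S (g : ℝ → ℂ) : ℝ → ℂ :=
  Classical.epsilon (IsSolution g)

/-- `T g = (S g)'''`. -/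
def T (g : ℝ → ℂ) : ℝ → ℂ :=
  iteratedDeriv 3 (S g)

/-- `α_j(g) = (1/2π) ∫_{-2}^{2} (T^j g)(t) √(4 - t²) dt`. -/
def alpha (j : ℕ) (g : ℝ → ℂ) : ℂ :=
  semicircleMean (T^[j] g)

/-- `E_k(g) = (1/π) ∫_{-2}^{2} g^{(k)}(x) T_k(x/2) / √(4 - x²) dx`, where `T_k` is the Chebyshev
polynomial of the first kind. -/
def E (k : ℕ) (g : ℝ → ℂ) : ℂ :=
  (1 / (Real.pi : ℂ)) * ∫ x in (-2 : ℝ)..2,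
    iteratedDeriv k g x *
      (((Polynomial.Chebyshev.T ℝ (k : ℤ)).eval (x / 2) / Real.sqrt (4 - x ^ 2) : ℝ) : ℂ)

/-- The constants `C_{j,r}`, for `j ≥ 1` and `2j ≤ r ≤ 3j - 1`, extended by zero to all other
indices: `C_{1,2} = 1`, and for `j ≥ 1` and `2j + 2 ≤ r ≤ 3j + 2`
`C_{j+1,r} = (2r-3)(2r-1)/(r+1) * ((r-1) C_{j,r-2} + (4r-10) C_{j,r-3})`. -/
def C : ℕ → ℕ → ℝ
  | 0, _ => 0
  | 1, r => if r = 2 then 1 else 0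
  | j + 2, r =>
    if 2 * (j + 1) + 2 ≤ r ∧ r ≤ 3 * (j + 1) + 2 then
      (2 * (r : ℝ) - 3) * (2 * (r : ℝ) - 1) / ((r : ℝ) + 1) *
        (((r : ℝ) - 1) * C (j + 1) (r - 2) + (4 * (r : ℝ) - 10) * C (j + 1) (r - 3))
    else 0

/-- `‖g‖_(N) = max_{i ≤ N} sup_x |g^{(i)}(x)|`. -/
def supNorm (N : ℕ) (g : ℝ → ℂ) : ℝ :=
  ⨆ i : Fin (N + 1), ⨆ x : ℝ, ‖iteratedDeriv (i : ℕ) g x‖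

/-- The distribution `Λ` on `ℝ` has order at most `N`: for every compact `K` there is a constant `c`
with `|Λ φ| ≤ c ‖φ‖_(N)` for all test functions `φ` supported in `K`. -/
def HasOrderAtMost (Λ : 𝓓((⊤ : TopologicalSpace.Opens ℝ), ℂ) →L[ℂ] ℂ) (N : ℕ) : Prop :=
  ∀ K : Set ℝ, IsCompact K → ∃ c : ℝ, ∀ φ : 𝓓((⊤ : TopologicalSpace.Opens ℝ), ℂ),
    tsupport φ ⊆ K → ‖Λ φ‖ ≤ c * supNorm N φ

end GUE

end

/-!
In the variable `x = 2 cos θ` the functionals `E_k` become cosine integrals. Rodrigues' formula,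
obtained by `k` integrations by parts, turns `E_k(g)` into a multiple of the moment
`I_k(g^{(2k)}) = ∫_0^π g^{(2k)}(2 cos θ) (2 sin θ)^{2k} dθ` (`cosIntegral_eq_sinMoment`,
`E_eq_sinMoment`), and the mean for the semicircle law is `I_1(g) / (2π)`. All identities between
these moments follow from one integration by parts, `I_{m+1}(F') = (2m+1) I_m(x F)`, and from
`x² = 4 - (2 sin θ)²`.

Let `f = S g`. Differentiating the equation for `f` and integrating by parts collapses
`I_{m+1}(g^{(2m+2)})` to a single moment `I_m(f^{(2m+1)})` of `f`
(`IsSolution.sinMoment_iteratedDeriv`). With `m = k + 1` and `m = k + 2` this expresses `E_k(f''')`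
through `E_{k+2}(g)` and `E_{k+3}(g)` (`IsSolution.normE_iteratedDeriv_three`). Iterating
`α_{j+1}(g) = α_j(T g)`, the coefficients obey the transposed recursion, which is the one
defining `C_{j,r}` (`sum_C_succ`).

The map `S` is a choice, so a smooth solution has to be produced. On `t < 2` the equation is
equivalent to an Euler equation with its singular point at `-2`, solved by an explicit integral that
is smooth across that point (`exists_smooth_solution_euler`); reflection gives a solution on
`t > -2`. The two agree on `(-2, 2)` because `g` minus its mean integrates to zero against
`√(4 - t²)` (`exists_isSolution`).

Finally each `E_k` is a continuous functional of `g^{(k)}`, bounded by its supremum and depending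
only on its values on `[-2, 2]`, so that the sum over `k ≤ 3j - 1` is a distribution with the
stated support and order.
-/

namespace GUE

open MeasureTheory Real

/-! ### Moments against even powers of the sine -/

/-- The moment `∫_0^π F(2 cos θ) (2 sin θ)^{2m} dθ`, which is
`∫_{-2}^{2} F(x) (4 - x²)^{m - 1/2} dx` in the variable `x = 2 cos θ`. -/
noncomputable def sinMoment (m : ℕ) (F : ℝ → ℂ) : ℂ :=
  ∫ θ in (0 : ℝ)..π, F (2 * cos θ) * ((2 * sin θ : ℝ) : ℂ) ^ (2 * m)

theorem intervalIntegrable_sinMoment (m : ℕ) {F : ℝ → ℂ} (hF : Continuous F) :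
    IntervalIntegrable (fun θ : ℝ => F (2 * cos θ) * ((2 * sin θ : ℝ) : ℂ) ^ (2 * m))
      volume 0 π := by
  apply Continuous.intervalIntegrable
  fun_prop

theorem sinMoment_add (m : ℕ) {F G : ℝ → ℂ} (hF : Continuous F) (hG : Continuous G) :
    sinMoment m (fun x => F x + G x) = sinMoment m F + sinMoment m G := by
  unfold sinMoment
  rw [← intervalIntegral.integral_add (intervalIntegrable_sinMoment m hF)
    (intervalIntegrable_sinMoment m hG)]
  simp only [add_mul]

theorem sinMoment_sub (m : ℕ) {F G : ℝ → ℂ} (hF : Continuous F) (hG : Continuous G) :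
    sinMoment m (fun x => F x - G x) = sinMoment m F - sinMoment m G := by
  unfold sinMoment
  rw [← intervalIntegral.integral_sub (intervalIntegrable_sinMoment m hF)
    (intervalIntegrable_sinMoment m hG)]
  simp only [sub_mul]

theorem sinMoment_const_mul (m : ℕ) (c : ℂ) (F : ℝ → ℂ) :
    sinMoment m (fun x => c * F x) = c * sinMoment m F := by
  unfold sinMoment
  rw [← intervalIntegral.integral_const_mul]
  simp only [mul_assoc]

/-- The identity `x² = 4 - (2 sin θ)²` for `x = 2 cos θ`. -/
theorem sinMoment_sq_mul (m : ℕ) {F : ℝ → ℂ} (hF : Continuous F) :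
    sinMoment m (fun x => (x : ℂ) * ((x : ℂ) * F x)) =
      4 * sinMoment m F - sinMoment (m + 1) F := by
  unfold sinMoment
  rw [← intervalIntegral.integral_const_mul, ← intervalIntegral.integral_sub
    ((intervalIntegrable_sinMoment m hF).const_mul 4) (intervalIntegrable_sinMoment (m + 1) hF)]
  refine intervalIntegral.integral_congr fun θ _ => ?_
  have h : ((cos θ : ℝ) : ℂ) ^ 2 = 1 - ((sin θ : ℝ) : ℂ) ^ 2 := by
    rw [eq_sub_iff_add_eq]; exact_mod_cast cos_sq_add_sin_sq θ
  have h2 : 2 * (m + 1) = 2 * m + 2 := by ring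
  simp only [h2, pow_add]
  push_cast
  push_cast at h
  linear_combination (4 * F (2 * cos θ) * (2 * Complex.sin θ) ^ (2 * m)) * h

/-- Integration by parts: the boundary terms vanish because of the factor `sin θ`. -/
theorem sinMoment_deriv (m : ℕ) {F : ℝ → ℂ} (hF : ContDiff ℝ ∞ F) :
    sinMoment (m + 1) (deriv F) = (2 * m + 1) * sinMoment m (fun x => (x : ℂ) * F x) := by
  have hF' : Continuous (deriv F) := hF.continuous_deriv (by norm_num)
  have hFc := hF.continuous
  have key : ∫ θ in (0 : ℝ)..π,
      ((2 * m + 1) * ((((2 * cos θ : ℝ) : ℂ) * F (2 * cos θ)) *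
        ((2 * sin θ : ℝ) : ℂ) ^ (2 * m)) -
        deriv F (2 * cos θ) * ((2 * sin θ : ℝ) : ℂ) ^ (2 * (m + 1))) = 0 := by
    rw [intervalIntegral.integral_eq_sub_of_hasDerivAt
      (f := fun θ : ℝ => F (2 * cos θ) * ((2 * sin θ : ℝ) : ℂ) ^ (2 * m + 1))]
    · simp
    · intro θ _
      have h1 : HasDerivAt (fun θ : ℝ => F (2 * cos θ)) ((2 * -sin θ) • deriv F (2 * cos θ)) θ :=
        HasDerivAt.scomp θ ((hF.differentiable (by norm_num)) _).hasDerivAt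
          ((hasDerivAt_cos θ).const_mul 2)
      have h2 : HasDerivAt (fun θ : ℝ => ((2 * sin θ : ℝ) : ℂ)) ((2 * cos θ : ℝ) : ℂ) θ :=
        ((hasDerivAt_sin θ).const_mul 2).ofReal_comp
      refine (h1.mul (h2.pow (2 * m + 1))).congr_deriv ?_
      have e : 2 * (m + 1) = (2 * m + 1) + 1 := by ring
      simp only [Pi.pow_apply, Complex.real_smul, e, Nat.add_sub_cancel]
      push_cast
      ring
    · apply Continuous.intervalIntegrable
      fun_prop
  rw [intervalIntegral.integral_sub, intervalIntegral.integral_const_mul, sub_eq_zero] at key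
  · exact key.symm
  · apply Continuous.intervalIntegrable; fun_prop
  · exact intervalIntegrable_sinMoment (m + 1) hF'

theorem hasDerivAt_ofReal_mul {F : ℝ → ℂ} {x : ℝ} (hF : DifferentiableAt ℝ F x) :
    HasDerivAt (fun x : ℝ => (x : ℂ) * F x) (F x + x * deriv F x) x := by
  have := (Complex.ofRealCLM.hasDerivAt (x := x)).mul hF.hasDerivAt
  simp only [Complex.ofRealCLM_apply, Complex.ofReal_one, one_mul] at this
  exact this

theorem contDiff_ofReal_mul {F : ℝ → ℂ} (hF : ContDiff ℝ ∞ F) :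
    ContDiff ℝ ∞ (fun x : ℝ => (x : ℂ) * F x) :=
  Complex.ofRealCLM.contDiff.mul hF

theorem contDiff_iteratedDeriv {F : ℝ → ℂ} (hF : ContDiff ℝ ∞ F) (n : ℕ) :
    ContDiff ℝ ∞ (iteratedDeriv n F) := by
  rw [iteratedDeriv_eq_iterate]
  exact hF.iterate_deriv n

theorem contDiff_deriv {F : ℝ → ℂ} (hF : ContDiff ℝ ∞ F) : ContDiff ℝ ∞ (deriv F) := by
  simpa using contDiff_iteratedDeriv hF 1

theorem sinMoment_mul_deriv (m : ℕ) {F : ℝ → ℂ} (hF : ContDiff ℝ ∞ F) :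
    sinMoment (m + 1) (fun x => (x : ℂ) * deriv F x) =
      4 * (2 * m + 1) * sinMoment m F - (2 * m + 2) * sinMoment (m + 1) F := by
  have h1 := sinMoment_deriv m (contDiff_ofReal_mul hF)
  have h2 : deriv (fun x : ℝ => (x : ℂ) * F x) = fun x => F x + x * deriv F x :=
    funext fun x => (hasDerivAt_ofReal_mul (hF.differentiable (by norm_num) x)).deriv
  have hd := (contDiff_ofReal_mul (contDiff_deriv hF)).continuous
  rw [h2, sinMoment_sq_mul m hF.continuous, sinMoment_add _ hF.continuous hd] at h1
  linear_combination h1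

theorem sinMoment_deriv_deriv (m : ℕ) {F : ℝ → ℂ} (hF : ContDiff ℝ ∞ F) :
    sinMoment (m + 2) (deriv (deriv F)) =
      (2 * m + 3) * sinMoment (m + 1) (fun x => (x : ℂ) * deriv F x) := by
  rw [sinMoment_deriv (m + 1) (contDiff_deriv hF)]
  push_cast
  ring

theorem iteratedDeriv_ofReal_mul {F : ℝ → ℂ} (hF : ContDiff ℝ ∞ F) (n : ℕ) :
    iteratedDeriv (n + 1) (fun x : ℝ => (x : ℂ) * F x) =
      fun x : ℝ => (x : ℂ) * iteratedDeriv (n + 1) F x + (n + 1) * iteratedDeriv n F x := by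
  have hd (k : ℕ) (x : ℝ) : DifferentiableAt ℝ (iteratedDeriv k F) x :=
    (contDiff_iteratedDeriv hF k).differentiable (by norm_num) x
  induction n with
  | zero =>
    funext x
    rw [zero_add, iteratedDeriv_one, iteratedDeriv_one, iteratedDeriv_zero,
      (hasDerivAt_ofReal_mul (hF.differentiable (by norm_num) x)).deriv]
    push_cast
    ring
  | succ n ih =>
    rw [iteratedDeriv_succ, ih]
    funext x
    have := (hasDerivAt_ofReal_mul (hd (n + 1) x)).add
      ((hd n x).hasDerivAt.const_mul ((n : ℂ) + 1))
    refine this.deriv.trans ?_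
    simp only [← iteratedDeriv_succ]
    push_cast
    ring

/-! ### Cosine integrals -/

/-- `∫_0^π h(2 cos θ) cos (kθ) dθ`. -/
noncomputable def cosIntegral (k : ℕ) (h : ℝ → ℂ) : ℂ :=
  ∫ θ in (0 : ℝ)..π, h (2 * cos θ) * ((cos (k * θ) : ℝ) : ℂ)

theorem cosIntegral_add_two (n : ℕ) {h : ℝ → ℂ} (hh : Continuous h) :
    cosIntegral (n + 2) h =
      cosIntegral (n + 1) (fun x => (x : ℂ) * h x) - cosIntegral n h := by
  unfold cosIntegral
  rw [← intervalIntegral.integral_sub]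
  · refine intervalIntegral.integral_congr fun θ _ => ?_
    have e1 : cos (((n + 2 : ℕ) : ℝ) * θ) + cos ((n : ℝ) * θ) =
        2 * cos θ * cos (((n + 1 : ℕ) : ℝ) * θ) := by
      have a : ((n + 2 : ℕ) : ℝ) * θ = ((n + 1 : ℕ) : ℝ) * θ + θ := by push_cast; ring
      have b : (n : ℝ) * θ = ((n + 1 : ℕ) : ℝ) * θ - θ := by push_cast; ring
      rw [a, b, cos_add, cos_sub]; ring
    have e2 : ((cos (((n + 2 : ℕ) : ℝ) * θ) : ℝ) : ℂ) + ((cos ((n : ℝ) * θ) : ℝ) : ℂ) =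
        ((2 * cos θ : ℝ) : ℂ) * ((cos (((n + 1 : ℕ) : ℝ) * θ) : ℝ) : ℂ) := by
      exact_mod_cast e1
    linear_combination h (2 * cos θ) * e2
  · apply Continuous.intervalIntegrable; fun_prop
  · apply Continuous.intervalIntegrable; fun_prop

theorem factorial_ratio_succ (n : ℕ) :
    (n.factorial : ℂ) / ((2 * n).factorial : ℂ) =
      2 * (2 * n + 1) * (((n + 1).factorial : ℂ) / ((2 * (n + 1)).factorial : ℂ)) := by
  have h : (2 * (n + 1)).factorial = (2 * n + 2) * ((2 * n + 1) * (2 * n).factorial) := by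
    rw [← Nat.factorial_succ (2 * n), ← Nat.factorial_succ (2 * n + 1)]; ring_nf
  have h0 : ((2 * n).factorial : ℂ) ≠ 0 := by exact_mod_cast Nat.factorial_ne_zero _
  have h1 : (2 * n + 2 : ℂ) ≠ 0 := by exact_mod_cast Nat.succ_ne_zero (2 * n + 1)
  have h2 : (2 * n + 1 : ℂ) ≠ 0 := by exact_mod_cast Nat.succ_ne_zero (2 * n)
  rw [h, Nat.factorial_succ]
  push_cast
  field_simp

/-- Rodrigues' formula for the Chebyshev polynomials, in integrated form: `k` integrations by parts
turn `cos (kθ)` into a multiple of `(2 sin θ)^{2k}`. Both sides satisfy the three-term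
recurrence of the Chebyshev polynomials. -/
theorem cosIntegral_eq_sinMoment (k : ℕ) {h : ℝ → ℂ} (hh : ContDiff ℝ ∞ h) :
    cosIntegral k h =
      (k.factorial : ℂ) / ((2 * k).factorial : ℂ) * sinMoment k (iteratedDeriv k h) := by
  induction k using Nat.twoStepInduction generalizing h with
  | zero => simp [cosIntegral, sinMoment]
  | one =>
    have : cosIntegral 1 h = 1 / 2 * sinMoment 0 (fun x => (x : ℂ) * h x) := by
      unfold cosIntegral sinMoment
      rw [← intervalIntegral.integral_const_mul]
      refine intervalIntegral.integral_congr fun θ _ => ?_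
      simp only [Nat.cast_one, one_mul, mul_zero, pow_zero, mul_one]
      push_cast
      ring
    rw [this, iteratedDeriv_one, sinMoment_deriv 0 hh]
    simp [Nat.factorial]
  | more n ih0 ih1 =>
    rw [cosIntegral_add_two n hh.continuous, ih0 hh, ih1 (contDiff_ofReal_mul hh),
      iteratedDeriv_ofReal_mul hh]
    have hF := contDiff_iteratedDeriv hh n
    have hc : Continuous fun x => ((n : ℂ) + 1) * iteratedDeriv n h x :=
      continuous_const.mul hF.continuous
    have hA := sinMoment_mul_deriv n hF
    have hB := sinMoment_deriv_deriv n hF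
    have e1 : iteratedDeriv (n + 1) h = deriv (iteratedDeriv n h) := iteratedDeriv_succ
    have e2 : iteratedDeriv (n + 2) h = deriv (deriv (iteratedDeriv n h)) := by
      rw [iteratedDeriv_succ, e1]
    rw [e1, e2, hB, sinMoment_add _ (contDiff_ofReal_mul (contDiff_deriv hF)).continuous
      hc, sinMoment_const_mul, factorial_ratio_succ n,
      factorial_ratio_succ (n + 1)]
    push_cast
    linear_combination (((n + 2).factorial : ℂ) / ((2 * (n + 2)).factorial : ℂ)) *
      (2 * n + 3) * hA

/-! ### The substitution `x = 2 cos θ` -/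

/-- No integrability is assumed, so that the formula applies to integrands that are singular at
`±2`. -/
theorem integral_two_mul_cos (φ : ℝ → ℂ) :
    ∫ x in (-2 : ℝ)..2, φ x = ∫ θ in Set.Ioo 0 π, ((2 * sin θ : ℝ) : ℂ) * φ (2 * cos θ) := by
  have him : (fun θ => 2 * cos θ) '' Set.Ioo 0 π = Set.Ioo (-2) 2 := by
    ext x
    constructor
    · rintro ⟨θ, hθ, rfl⟩
      have h1 : cos θ < 1 := by
        simpa using cos_lt_cos_of_nonneg_of_le_pi le_rfl hθ.2.le hθ.1
      have h2 : -1 < cos θ := by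
        simpa using cos_lt_cos_of_nonneg_of_le_pi hθ.1.le le_rfl hθ.2
      constructor <;> simp only <;> linarith
    · intro hx
      refine ⟨arccos (x / 2), ⟨?_, ?_⟩, ?_⟩
      · rw [arccos_pos]; linarith [hx.2]
      · refine lt_of_le_of_ne (arccos_le_pi _) fun h => ?_
        rw [arccos_eq_pi] at h; linarith [hx.1]
      · simp only
        rw [cos_arccos (by linarith [hx.1]) (by linarith [hx.2])]; ring
  rw [intervalIntegral.integral_of_le (by norm_num), integral_Ioc_eq_integral_Ioo, ← him,
    integral_image_eq_integral_abs_deriv_smul measurableSet_Ioo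
      (f' := fun θ => 2 * -sin θ) (fun θ _ => ((hasDerivAt_cos θ).const_mul 2).hasDerivWithinAt)]
  · refine setIntegral_congr_fun measurableSet_Ioo fun θ hθ => ?_
    have := sin_pos_of_pos_of_lt_pi hθ.1 hθ.2
    simp only [Complex.real_smul]
    rw [mul_neg, abs_neg, abs_of_pos (by positivity)]
  · intro a ha b hb hab
    exact injOn_cos ⟨ha.1.le, ha.2.le⟩ ⟨hb.1.le, hb.2.le⟩ (by simpa using hab)

theorem sqrt_four_sub_sq_two_mul_cos {θ : ℝ} (hθ : θ ∈ Set.Ioo 0 π) :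
    √(4 - (2 * cos θ) ^ 2) = 2 * sin θ := by
  have := sin_pos_of_pos_of_lt_pi hθ.1 hθ.2
  rw [show 4 - (2 * cos θ) ^ 2 = (2 * sin θ) ^ 2 by
    linear_combination (-4) * (cos_sq_add_sin_sq θ), sqrt_sq (by positivity)]

theorem semicircleMean_eq (g : ℝ → ℂ) :
    semicircleMean g = 1 / (2 * (π : ℂ)) * sinMoment 1 g := by
  unfold semicircleMean sinMoment
  rw [integral_two_mul_cos, intervalIntegral.integral_of_le pi_pos.le, integral_Ioc_eq_integral_Ioo]
  congr 1
  refine setIntegral_congr_fun measurableSet_Ioo fun θ hθ => ?_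
  rw [sqrt_four_sub_sq_two_mul_cos hθ]
  ring

theorem E_eq_cosIntegral (k : ℕ) (g : ℝ → ℂ) :
    E k g = 1 / (π : ℂ) * cosIntegral k (iteratedDeriv k g) := by
  unfold E cosIntegral
  rw [integral_two_mul_cos, intervalIntegral.integral_of_le pi_pos.le, integral_Ioc_eq_integral_Ioo]
  congr 1
  refine setIntegral_congr_fun measurableSet_Ioo fun θ hθ => ?_
  have h0 : ((sin θ : ℝ) : ℂ) ≠ 0 := by
    exact_mod_cast (sin_pos_of_pos_of_lt_pi hθ.1 hθ.2).ne'
  rw [sqrt_four_sub_sq_two_mul_cos hθ, mul_div_cancel_left₀ _ two_ne_zero,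
    Polynomial.Chebyshev.T_real_cos]
  push_cast at h0 ⊢
  field_simp

theorem iteratedDeriv_iteratedDeriv (m n : ℕ) (g : ℝ → ℂ) :
    iteratedDeriv m (iteratedDeriv n g) = iteratedDeriv (m + n) g := by
  simp only [iteratedDeriv_eq_iterate, Function.iterate_add_apply]

theorem E_eq_sinMoment (k : ℕ) {g : ℝ → ℂ} (hg : ContDiff ℝ ∞ g) :
    E k g = 1 / (π : ℂ) * ((k.factorial : ℂ) / ((2 * k).factorial : ℂ) *
      sinMoment k (iteratedDeriv (2 * k) g)) := by
  rw [E_eq_cosIntegral, cosIntegral_eq_sinMoment k (contDiff_iteratedDeriv hg k),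
    iteratedDeriv_iteratedDeriv, two_mul]

/-! ### The effect of `T` on the functionals `E_k` -/

/-- The differential equation for `f`, differentiated `n + 1` times. -/
theorem IsSolution.iteratedDeriv_succ {g f : ℝ → ℂ} (h : IsSolution g f) (n : ℕ) :
    iteratedDeriv (n + 1) g = fun t : ℝ =>
      ((t : ℂ) * (t * iteratedDeriv (n + 2) f t) - 4 * iteratedDeriv (n + 2) f t) +
        (2 * n + 5) * (t * iteratedDeriv (n + 1) f t) +
        (n + 1) * (n + 3) * iteratedDeriv n f t := by
  obtain ⟨hf, h⟩ := h
  have hd (k : ℕ) (x : ℝ) : DifferentiableAt ℝ (iteratedDeriv k f) x :=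
    (contDiff_iteratedDeriv hf k).differentiable (by norm_num) x
  have hx (k : ℕ) (x : ℝ) : HasDerivAt (fun t : ℝ => (t : ℂ) * iteratedDeriv k f t)
      (iteratedDeriv k f x + x * iteratedDeriv (k + 1) f x) x := by
    rw [_root_.iteratedDeriv_succ]
    exact hasDerivAt_ofReal_mul (hd k x)
  have hxx (k : ℕ) (x : ℝ) :
      HasDerivAt (fun t : ℝ => (t : ℂ) * ((t : ℂ) * iteratedDeriv k f t))
      (x * iteratedDeriv k f x +
        x * (iteratedDeriv k f x + x * iteratedDeriv (k + 1) f x)) x := by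
    have := hasDerivAt_ofReal_mul (hx k x).differentiableAt
    rwa [(hx k x).deriv] at this
  have hd' (k : ℕ) (x : ℝ) : HasDerivAt (iteratedDeriv k f) (iteratedDeriv (k + 1) f x) x := by
    rw [_root_.iteratedDeriv_succ]
    exact (hd k x).hasDerivAt
  induction n with
  | zero =>
    have hg : g = fun t : ℝ => semicircleMean g +
        (((t : ℂ) * (t * iteratedDeriv 1 f t) - 4 * iteratedDeriv 1 f t) +
        3 * (t * iteratedDeriv 0 f t)) := by
      funext t
      rw [iteratedDeriv_one, iteratedDeriv_zero]
      linear_combination h t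
    funext t
    rw [zero_add, iteratedDeriv_one]
    conv_lhs => rw [hg]
    refine ((((hxx 1 t).sub ((hd' 1 t).const_mul 4)).add
      ((hx 0 t).const_mul 3)).const_add _).deriv.trans ?_
    push_cast
    ring
  | succ n ih =>
    funext t
    rw [_root_.iteratedDeriv_succ, ih]
    refine ((((hxx (n + 2) t).sub ((hd' (n + 2) t).const_mul 4)).add
      ((hx (n + 1) t).const_mul (2 * n + 5 : ℂ))).add
      ((hd' n t).const_mul ((n + 1) * (n + 3) : ℂ))).deriv.trans ?_
    push_cast
    ring

/-- The order `2m + 2` and the exponent `m + 1` match: after the integrations by parts the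
moment of `g^{(2m+2)}` becomes one single moment of `f`, one step lower. -/
theorem IsSolution.sinMoment_iteratedDeriv {g f : ℝ → ℂ} (h : IsSolution g f) (m : ℕ) :
    sinMoment (m + 1) (iteratedDeriv (2 * m + 2) g) =
      4 * (2 * m + 1) * (2 * m + 4) * sinMoment m (iteratedDeriv (2 * m + 1) f) := by
  have hF := contDiff_iteratedDeriv h.1 (2 * m + 1)
  have e1 : iteratedDeriv (2 * m + 2) f = deriv (iteratedDeriv (2 * m + 1) f) :=
    _root_.iteratedDeriv_succ
  have e2 : iteratedDeriv (2 * m + 3) f = deriv (deriv (iteratedDeriv (2 * m + 1) f)) := by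
    rw [_root_.iteratedDeriv_succ, e1]
  rw [h.iteratedDeriv_succ (2 * m + 1)]
  simp only [add_assoc, Nat.reduceAdd]
  rw [e1, e2]
  generalize iteratedDeriv (2 * m + 1) f = F at hF ⊢
  have c0 : Continuous F := hF.continuous
  have c1 : Continuous (deriv F) := (contDiff_deriv hF).continuous
  have c2 : Continuous (deriv (deriv F)) := (contDiff_deriv (contDiff_deriv hF)).continuous
  have hA := sinMoment_mul_deriv m hF
  have hB := sinMoment_deriv_deriv m hF
  rw [sinMoment_add _ (by fun_prop) (by fun_prop), sinMoment_add _ (by fun_prop) (by fun_prop),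
    sinMoment_sub _ (by fun_prop) (by fun_prop), sinMoment_sq_mul _ c2,
    sinMoment_const_mul, sinMoment_const_mul, sinMoment_const_mul, hB]
  push_cast
  linear_combination (2 * m + 4) * hA

/-- The functional `E_k`, normalised by the factor `k! / (2k)!`. -/
noncomputable def normE (k : ℕ) (g : ℝ → ℂ) : ℂ :=
  (k.factorial : ℂ) / ((2 * k).factorial : ℂ) * E k g

/-- The coefficient `(2r-3)(2r-1)/(r+1)` in the recursion for the constants `C_{j,r}`. -/
noncomputable def recCoeff (r : ℕ) : ℝ :=
  (2 * (r : ℝ) - 3) * (2 * (r : ℝ) - 1) / ((r : ℝ) + 1)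

theorem normE_eq_sinMoment (k : ℕ) {g : ℝ → ℂ} (hg : ContDiff ℝ ∞ g) :
    normE k g = 1 / (π : ℂ) * ((k.factorial : ℂ) / ((2 * k).factorial : ℂ)) ^ 2 *
      sinMoment k (iteratedDeriv (2 * k) g) := by
  rw [normE, E_eq_sinMoment k hg]
  ring

theorem IsSolution.normE_iteratedDeriv_three {g f : ℝ → ℂ} (h : IsSolution g f)
    (hg : ContDiff ℝ ∞ g) (k : ℕ) :
    normE k (iteratedDeriv 3 f) =
      (recCoeff (k + 2) * (k + 1)) * normE (k + 2) g +
      (recCoeff (k + 3) * (4 * k + 2)) * normE (k + 3) g := by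
  rw [normE_eq_sinMoment k (contDiff_iteratedDeriv h.1 3), normE_eq_sinMoment _ hg,
    normE_eq_sinMoment _ hg, iteratedDeriv_iteratedDeriv]
  have h2 := h.sinMoment_iteratedDeriv (k + 1)
  have h3 := h.sinMoment_iteratedDeriv (k + 2)
  have hF := contDiff_iteratedDeriv h.1 (2 * k + 3)
  have hA := sinMoment_mul_deriv k hF
  have hB := sinMoment_deriv_deriv k hF
  have e2 : iteratedDeriv (2 * k + 5) f = deriv (deriv (iteratedDeriv (2 * k + 3) f)) := by
    rw [_root_.iteratedDeriv_succ, _root_.iteratedDeriv_succ]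
  simp only [show 2 * (k + 1) + 2 = 2 * (k + 2) by ring, show k + 1 + 1 = k + 2 by ring,
    show 2 * (k + 1) + 1 = 2 * k + 3 by ring] at h2
  simp only [show 2 * (k + 2) + 2 = 2 * (k + 3) by ring, show k + 2 + 1 = k + 3 by ring,
    show 2 * (k + 2) + 1 = 2 * k + 5 by ring, e2, hB, hA] at h3
  rw [h2, h3, factorial_ratio_succ k, factorial_ratio_succ (k + 1),
    factorial_ratio_succ (k + 2), recCoeff, recCoeff]
  have n1 : (k + 2 + 1 : ℂ) ≠ 0 := by exact_mod_cast Nat.succ_ne_zero (k + 2)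
  have n2 : (k + 3 + 1 : ℂ) ≠ 0 := by exact_mod_cast Nat.succ_ne_zero (k + 3)
  have n3 : (π : ℂ) ≠ 0 := by exact_mod_cast pi_ne_zero
  generalize (((k + 2 + 1).factorial : ℂ) / ((2 * (k + 2 + 1)).factorial : ℂ)) = c
  generalize sinMoment k (iteratedDeriv (2 * k + 3) f) = a
  generalize sinMoment (k + 1) (iteratedDeriv (2 * k + 3) f) = b
  push_cast
  field_simp
  ring

theorem IsSolution.semicircleMean_iteratedDeriv_three {g f : ℝ → ℂ} (h : IsSolution g f)
    (hg : ContDiff ℝ ∞ g) : semicircleMean (iteratedDeriv 3 f) = normE 2 g := by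
  have h1 := h.sinMoment_iteratedDeriv 1
  simp only [Nat.reduceAdd, Nat.reduceMul] at h1
  rw [semicircleMean_eq, normE_eq_sinMoment _ hg, h1]
  simp only [Nat.factorial]
  have n3 : (π : ℂ) ≠ 0 := by exact_mod_cast pi_ne_zero
  push_cast
  field_simp
  ring

/-! ### The constants `C_{j,r}` -/

theorem C_eq_zero {j r : ℕ} (hj : 1 ≤ j) (h : r < 2 * j ∨ 3 * j ≤ r) : C j r = 0 := by
  match j, hj with
  | 1, _ => rw [C, if_neg (by omega)]
  | j + 2, _ => rw [C, if_neg (by omega)]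

/-- The recursion holds without restriction on `r`: outside its range both sides vanish. -/
theorem C_succ {j : ℕ} (hj : 1 ≤ j) (r : ℕ) :
    C (j + 1) r = recCoeff r *
      (((r : ℝ) - 1) * C j (r - 2) + (4 * (r : ℝ) - 10) * C j (r - 3)) := by
  obtain ⟨i, rfl⟩ : ∃ i, j = i + 1 := ⟨j - 1, by omega⟩
  by_cases h : 2 * (i + 1) + 2 ≤ r ∧ r ≤ 3 * (i + 1) + 2
  · rw [C, if_pos h, recCoeff]
  · rw [C_eq_zero (by omega) (r := r) (by omega), C_eq_zero hj (r := r - 2) (by omega),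
      C_eq_zero hj (r := r - 3) (by omega)]
    ring

theorem sum_C_mul_eq_sum_range {j N : ℕ} (hj : 1 ≤ j) (hN : 3 * j ≤ N) (X : ℕ → ℂ) :
    ∑ k ∈ Finset.Icc (2 * j) (3 * j - 1), (C j k : ℂ) * X k =
      ∑ k ∈ Finset.range N, (C j k : ℂ) * X k := by
  refine Finset.sum_subset (fun k hk => ?_) fun k _ hk => ?_
  · rw [Finset.mem_Icc] at hk
    rw [Finset.mem_range]
    omega
  · rw [Finset.mem_Icc] at hk
    rw [C_eq_zero hj (by omega)]
    simp

/-- Reindexing by `r = k + 2` and `r = k + 3` turns the two-term expression in `e` into the recursion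
for `C_{j,r}`. -/
theorem sum_C_succ {j : ℕ} (hj : 1 ≤ j) (e : ℕ → ℂ) :
    ∑ k ∈ Finset.Icc (2 * j) (3 * j - 1), (C j k : ℂ) *
        ((recCoeff (k + 2) * (k + 1)) * e (k + 2) +
          (recCoeff (k + 3) * (4 * k + 2)) * e (k + 3)) =
      ∑ r ∈ Finset.Icc (2 * (j + 1)) (3 * (j + 1) - 1), (C (j + 1) r : ℂ) * e r := by
  have hz {r : ℕ} (h : r < 2 * j ∨ 3 * j ≤ r) : C j r = 0 := C_eq_zero hj h
  rw [sum_C_mul_eq_sum_range hj (N := 3 * j + 1) (by omega),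
    sum_C_mul_eq_sum_range (j := j + 1) (by omega) (N := 3 * j + 3) (by omega)]
  have hr (r : ℕ) : (C (j + 1) r : ℂ) * e r =
      (recCoeff r * (r - 1) * C j (r - 2)) * e r +
        (recCoeff r * (4 * r - 10) * C j (r - 3)) * e r := by
    rw [C_succ hj]
    push_cast
    ring
  simp only [hr, Finset.sum_add_distrib, mul_add]
  congr 1
  · rw [Finset.sum_range_succ' _ (3 * j + 2), Finset.sum_range_succ' _ (3 * j + 1),
      hz (r := 0 + 1 - 2) (by omega)]
    simp only [Complex.ofReal_zero, mul_zero, zero_mul, add_zero]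
    refine Finset.sum_congr rfl fun k _ => ?_
    simp only [add_assoc, Nat.reduceAdd, Nat.add_sub_cancel]
    push_cast
    ring
  · rw [Finset.sum_range_succ, hz (r := 3 * j) (by omega), Finset.sum_range_succ' _ (3 * j + 2),
      Finset.sum_range_succ' _ (3 * j + 1), Finset.sum_range_succ' _ (3 * j),
      hz (r := 0 + 1 + 1 - 3) (by omega)]
    simp only [Complex.ofReal_zero, mul_zero, zero_mul, add_zero]
    refine Finset.sum_congr rfl fun k _ => ?_
    simp only [add_assoc, Nat.reduceAdd, Nat.add_sub_cancel]
    push_cast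
    ring

open Set

/-! ### Existence of the smooth solution -/

theorem mul_sq_mem_Iio {b t v : ℝ} (hb : 0 < b) (ht : t < b) (hv : v ∈ Icc (0 : ℝ) 1) :
    t * v ^ 2 < b := by
  have h1 : v ^ 2 ≤ 1 := pow_le_one₀ hv.1 hv.2
  rcases le_or_gt t 0 with h | h
  · nlinarith [sq_nonneg v]
  · nlinarith

theorem continuousOn_pow_mul_comp {b t : ℝ} (hb : 0 < b) (ht : t < b) {φ : ℝ → ℂ}
    (hφ : ContinuousOn φ (Iio b)) (m : ℕ) :
    ContinuousOn (fun v : ℝ => (v : ℂ) ^ m * φ (t * v ^ 2)) (Icc 0 1) :=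
  ContinuousOn.mul (by fun_prop)
    (hφ.comp (by fun_prop) fun _ hv => mul_sq_mem_Iio hb ht hv)

theorem hasDerivAt_integral_pow_mul_comp {b t : ℝ} (hb : 0 < b) (ht : t < b) {φ : ℝ → ℂ}
    (hφ : ContDiffOn ℝ ∞ φ (Iio b)) (m : ℕ) :
    HasDerivAt (fun t : ℝ => ∫ v in (0 : ℝ)..1, (v : ℂ) ^ m * φ (t * v ^ 2))
      (∫ v in (0 : ℝ)..1, (v : ℂ) ^ (m + 2) * deriv φ (t * v ^ 2)) t := by
  have hφ' : ContinuousOn (deriv φ) (Iio b) :=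
    hφ.continuousOn_deriv_of_isOpen isOpen_Iio (by norm_num)
  obtain ⟨c, htc, hcb⟩ := exists_between ht
  have hsub : uIoc (0 : ℝ) 1 ⊆ Icc 0 1 := by
    rw [uIoc_of_le zero_le_one]; exact Ioc_subset_Icc_self
  have hint {s : ℝ} (hs : s < b) {ψ : ℝ → ℂ} (hψ : ContinuousOn ψ (Iio b)) (m : ℕ) :
      IntervalIntegrable (fun v : ℝ => (v : ℂ) ^ m * ψ (s * v ^ 2)) volume 0 1 := by
    apply ContinuousOn.intervalIntegrable
    rw [uIcc_of_le zero_le_one]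
    exact continuousOn_pow_mul_comp hb hs hψ m
  -- For `s` near `t` the points `s v²` stay in one compact subset of the half-line.
  obtain ⟨M, hM⟩ : ∃ M, ∀ x ∈ Icc (-|t - 1|) (max c 0), ‖deriv φ x‖ ≤ M :=
    isCompact_Icc.exists_bound_of_continuousOn
      (hφ'.mono fun x hx => lt_of_le_of_lt hx.2 (max_lt hcb hb))
  have hmem {s v : ℝ} (hs : s ∈ Ioo (t - 1) c) (hv : v ∈ Icc (0 : ℝ) 1) :
      s * v ^ 2 ∈ Icc (-|t - 1|) (max c 0) := by
    have h1 : v ^ 2 ≤ 1 := pow_le_one₀ hv.1 hv.2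
    have h2 := neg_abs_le (t - 1)
    have h3 := abs_nonneg (t - 1)
    have h4 := le_max_left c 0
    have h5 := le_max_right c 0
    have h6 := sq_nonneg v
    obtain ⟨hs1, hs2⟩ := hs
    constructor
    · nlinarith
    · nlinarith
  refine (intervalIntegral.hasDerivAt_integral_of_dominated_loc_of_deriv_le
    (F := fun t v => (v : ℂ) ^ m * φ (t * v ^ 2))
    (F' := fun t v => (v : ℂ) ^ (m + 2) * deriv φ (t * v ^ 2)) (bound := fun _ => M)
    (Ioo_mem_nhds (by linarith : t - 1 < t) htc) ?_ (hint ht hφ.continuousOn m)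
    (hint ht hφ' (m + 2)).aestronglyMeasurable_restrict_uIoc
    ?_ intervalIntegrable_const ?_).2
  · filter_upwards [Iio_mem_nhds ht] with s hs
    exact (hint hs hφ.continuousOn m).aestronglyMeasurable_restrict_uIoc
  · refine Filter.Eventually.of_forall fun v hv s hs => ?_
    have h1 : ‖(v : ℂ) ^ (m + 2)‖ ≤ 1 := by
      rw [norm_pow, Complex.norm_real, Real.norm_eq_abs, abs_of_nonneg (hsub hv).1]
      exact pow_le_one₀ (hsub hv).1 (hsub hv).2
    rw [norm_mul]
    calc _ ≤ 1 * M := by gcongr; exact hM _ (hmem hs (hsub hv))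
      _ = M := one_mul M
  · refine Filter.Eventually.of_forall fun v hv s hs => ?_
    have hlt : s * v ^ 2 < b := mul_sq_mem_Iio hb (hs.2.trans hcb) (hsub hv)
    have h1 : HasDerivAt φ (deriv φ (s * v ^ 2)) (s * v ^ 2) :=
      ((hφ.differentiableOn (by norm_num)).differentiableAt (Iio_mem_nhds hlt)).hasDerivAt
    have h2 : HasDerivAt (fun s : ℝ => φ (s * v ^ 2)) ((1 * v ^ 2) • deriv φ (s * v ^ 2)) s :=
      HasDerivAt.scomp s h1 ((hasDerivAt_id s).mul_const (v ^ 2))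
    refine (h2.const_mul _).congr_deriv ?_
    rw [Complex.real_smul]
    push_cast
    ring

theorem contDiffOn_integral_pow_mul_comp {b : ℝ} (hb : 0 < b) (n : ℕ) {φ : ℝ → ℂ}
    (hφ : ContDiffOn ℝ ∞ φ (Iio b)) (m : ℕ) :
    ContDiffOn ℝ n (fun t : ℝ => ∫ v in (0 : ℝ)..1, (v : ℂ) ^ m * φ (t * v ^ 2)) (Iio b) := by
  induction n generalizing φ m with
  | zero =>
    exact contDiffOn_zero.2 fun t ht =>
      (hasDerivAt_integral_pow_mul_comp hb ht hφ m).continuousAt.continuousWithinAt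
  | succ n ih =>
    rw [Nat.cast_succ, contDiffOn_succ_iff_deriv_of_isOpen isOpen_Iio]
    refine ⟨fun t ht => (hasDerivAt_integral_pow_mul_comp hb ht
      hφ m).differentiableAt.differentiableWithinAt, by simp, ?_⟩
    refine (ih (hφ.deriv_of_isOpen isOpen_Iio (m := ∞) (by norm_num)) (m + 2)).congr
      fun t ht => ?_
    exact (hasDerivAt_integral_pow_mul_comp hb ht hφ m).deriv

/-- The Euler equation `t G' + (3/2) G = φ` has the solution `G(t) = 2 ∫_0^1 v² φ(t v²) dv`, which
is smooth across the singular point `0`. -/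
theorem exists_smooth_solution_euler {b : ℝ} (hb : 0 < b) {φ : ℝ → ℂ}
    (hφ : ContDiffOn ℝ ∞ φ (Iio b)) :
    ∃ G : ℝ → ℂ, ContDiffOn ℝ ∞ G (Iio b) ∧
      ∀ t < b, (t : ℂ) * deriv G t + 3 / 2 * G t = φ t := by
  have hφ' : ContinuousOn (deriv φ) (Iio b) :=
    hφ.continuousOn_deriv_of_isOpen isOpen_Iio (by norm_num)
  refine ⟨fun t => 2 * ∫ v in (0 : ℝ)..1, (v : ℂ) ^ 2 * φ (t * v ^ 2), ?_, fun t ht => ?_⟩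
  · refine contDiffOn_const.mul (contDiffOn_infty.2 fun n => ?_)
    exact contDiffOn_integral_pow_mul_comp hb n hφ 2
  have hint {ψ : ℝ → ℂ} (hψ : ContinuousOn ψ (Iio b)) (m : ℕ) :
      IntervalIntegrable (fun v : ℝ => (v : ℂ) ^ m * ψ (t * v ^ 2)) volume 0 1 := by
    apply ContinuousOn.intervalIntegrable
    rw [uIcc_of_le zero_le_one]
    exact continuousOn_pow_mul_comp hb ht hψ m
  have h2 := hint hφ.continuousOn 2
  have h4 := hint hφ' 4
  rw [((hasDerivAt_integral_pow_mul_comp hb ht hφ 2).const_mul 2).deriv]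
  -- The fundamental theorem of calculus for `v ↦ v³ φ(t v²)`.
  have key : ∫ v in (0 : ℝ)..1, (3 * ((v : ℂ) ^ 2 * φ (t * v ^ 2)) +
      (2 * t) * ((v : ℂ) ^ 4 * deriv φ (t * v ^ 2))) = φ t := by
    rw [intervalIntegral.integral_eq_sub_of_hasDerivAt
      (f := fun v : ℝ => (v : ℂ) ^ 3 * φ (t * v ^ 2))]
    · simp
    · intro v hv
      rw [uIcc_of_le zero_le_one] at hv
      have hlt : t * v ^ 2 < b := mul_sq_mem_Iio hb ht hv
      have h1 : HasDerivAt φ (deriv φ (t * v ^ 2)) (t * v ^ 2) :=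
        ((hφ.differentiableOn (by norm_num)).differentiableAt (Iio_mem_nhds hlt)).hasDerivAt
      have h2 := HasDerivAt.scomp v h1 ((hasDerivAt_pow 2 v).const_mul t)
      have h3 := (hasDerivAt_id v).ofReal_comp.pow 3
      refine (h3.mul h2).congr_deriv ?_
      simp only [Complex.real_smul, Pi.pow_apply, id, Function.comp]
      push_cast
      ring
    · exact (h2.const_mul 3).add (h4.const_mul _)
  rw [intervalIntegral.integral_add (h2.const_mul 3) (h4.const_mul _),
    intervalIntegral.integral_const_mul, intervalIntegral.integral_const_mul] at key
  simp only [Nat.reduceAdd]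
  linear_combination key

/-- On the half-line `t < 2` the equation has only the singular point `-2`; the substitution
`f = -(2 - t)^{-3/2} G(t + 2)` turns it into an Euler equation. -/
theorem exists_solution_Iio {h : ℝ → ℂ} (hh : ContDiff ℝ ∞ h) :
    ∃ f : ℝ → ℂ, ContDiffOn ℝ ∞ f (Iio 2) ∧
      ∀ t : ℝ, t < 2 → ((t : ℂ) ^ 2 - 4) * deriv f t + 3 * t * f t = h t := by
  obtain ⟨G, hG, hGe⟩ := exists_smooth_solution_euler (b := 4) (by norm_num)
    (φ := fun s => h (s - 2) * (√(4 - s) : ℝ)) (by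
      refine ContDiffOn.mul (hh.comp (contDiff_id.sub contDiff_const)).contDiffOn ?_
      refine Complex.ofRealCLM.contDiff.comp_contDiffOn
        (ContDiffOn.sqrt (contDiffOn_const.sub contDiffOn_id) fun s hs => ?_)
      exact (sub_pos.2 hs).ne')
  have hGs : ContDiffOn ℝ ∞ (fun t => G (t + 2)) (Iio 2) :=
    hG.comp (contDiff_id.add contDiff_const).contDiffOn fun t (ht : t < 2) => by
      simp only [mem_Iio]; linarith
  refine ⟨fun t => -((((2 - t) * √(2 - t))⁻¹ : ℝ) : ℂ) * G (t + 2), ?_, fun t ht => ?_⟩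
  · refine ContDiffOn.mul (ContDiffOn.neg ?_) hGs
    have hc : ContDiffOn ℝ ∞ (fun t : ℝ => 2 - t) (Iio 2) := contDiffOn_const.sub contDiffOn_id
    refine Complex.ofRealCLM.contDiff.comp_contDiffOn ((hc.mul (hc.sqrt fun t ht => ?_)).inv
      fun t ht => ?_)
    · exact (sub_pos.2 ht).ne'
    · have : 0 < 2 - t := sub_pos.2 ht
      positivity
  · have hu : 0 < 2 - t := sub_pos.2 ht
    have hr : 0 < √(2 - t) := sqrt_pos.2 hu
    have hu1 : HasDerivAt (fun t : ℝ => 2 - t) (-1) t := by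
      simpa using (hasDerivAt_id t).const_sub 2
    obtain ⟨q', hq, hq'⟩ : ∃ q', HasDerivAt (fun t : ℝ => ((2 - t) * √(2 - t))⁻¹) q' t ∧
        (2 - t) * q' = 3 / 2 * ((2 - t) * √(2 - t))⁻¹ := by
      refine ⟨_, (hu1.mul (hu1.sqrt hu.ne')).inv (mul_pos hu hr).ne', ?_⟩
      simp only [Pi.mul_apply]
      have hs : √(2 - t) ^ 2 = 2 - t := sq_sqrt hu.le
      generalize √(2 - t) = r at *
      rw [← hs]
      field_simp
      ring
    have hqr : (2 - t) * ((2 - t) * √(2 - t))⁻¹ * √(2 - t) = 1 := by field_simp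
    have hGd : HasDerivAt (fun t => G (t + 2)) (deriv G (t + 2)) t := by
      have hd : DifferentiableAt ℝ G (t + 2) :=
        (hG.differentiableOn (by norm_num)).differentiableAt (Iio_mem_nhds (by linarith))
      simpa using hd.hasDerivAt.comp_add_const t 2
    have hf : deriv (fun t : ℝ => -((((2 - t) * √(2 - t))⁻¹ : ℝ) : ℂ) * G (t + 2)) t = _ :=
      (hq.ofReal_comp.neg.mul hGd).deriv
    have he := hGe (t + 2) (by linarith)
    simp only [add_sub_cancel_right, show 4 - (t + 2) = 2 - t by ring] at he
    rw [hf]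
    simp only [Pi.neg_apply]
    generalize ((2 - t) * √(2 - t))⁻¹ = q at *
    replace hq' : (2 - (t : ℂ)) * q' = 3 / 2 * q := by
      simpa using congrArg Complex.ofReal hq'
    replace hqr : (2 - (t : ℂ)) * q * (√(2 - t) : ℝ) = 1 := by
      exact_mod_cast congrArg Complex.ofReal hqr
    push_cast at he
    linear_combination (t + 2) * G (t + 2) * hq' + (2 - t) * q * he + h t * hqr


/-- The mirror image of `exists_solution_Iio`: if `f` solves the equation for `h(-t)`, then
`-f(-t)` solves it for `h`. -/
theorem exists_solution_Ioi {h : ℝ → ℂ} (hh : ContDiff ℝ ∞ h) :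
    ∃ f : ℝ → ℂ, ContDiffOn ℝ ∞ f (Ioi (-2)) ∧
      ∀ t : ℝ, -2 < t → ((t : ℂ) ^ 2 - 4) * deriv f t + 3 * t * f t = h t := by
  obtain ⟨f, hf, hfe⟩ := exists_solution_Iio (hh.comp contDiff_neg)
  refine ⟨fun t => -f (-t), ?_, fun t ht => ?_⟩
  · exact (hf.comp contDiff_neg.contDiffOn fun t (ht : -2 < t) => by
      simp only [mem_Iio]; linarith).neg
  · have := hfe (-t) (by linarith)
    simp only [Function.comp, neg_neg] at this
    rw [deriv.fun_neg, deriv_comp_neg, ← this]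
    push_cast
    ring

/-- The weight `(4 - t²)^{3/2}` is an integrating factor of the equation on `[-2, 2]`. -/
theorem integral_mul_sqrt_eq_of_solution {h f : ℝ → ℂ} (hh : Continuous h) {a b : ℝ}
    (ha : -2 ≤ a) (hab : a ≤ b) (hb : b ≤ 2) (hf : ∀ t ∈ Icc a b, DifferentiableAt ℝ f t)
    (hfe : ∀ t ∈ Icc a b, ((t : ℂ) ^ 2 - 4) * deriv f t + 3 * t * f t = h t) :
    ∫ t in a..b, h t * (√(4 - t ^ 2) : ℝ) =
      (((4 - a ^ 2) * √(4 - a ^ 2) : ℝ) : ℂ) * f a -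
        (((4 - b ^ 2) * √(4 - b ^ 2) : ℝ) : ℂ) * f b := by
  have key := intervalIntegral.integral_eq_sub_of_hasDerivAt_of_le hab
    (f := fun t : ℝ => -((((4 - t ^ 2) * √(4 - t ^ 2) : ℝ) : ℂ) * f t))
    (f' := fun t : ℝ => h t * (√(4 - t ^ 2) : ℝ)) ?_ ?_ ?_
  · rw [key]; ring
  · have : ContinuousOn f (Icc a b) := fun t ht => (hf t ht).continuousAt.continuousWithinAt
    fun_prop
  · intro t ht
    have ht' := Ioo_subset_Icc_self ht
    have hu : 0 < 4 - t ^ 2 := by nlinarith [ht.1, ht.2]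
    have hu1 : HasDerivAt (fun t : ℝ => 4 - t ^ 2) (-(2 * t)) t := by
      simpa using (hasDerivAt_pow 2 t).const_sub 4
    have hp : HasDerivAt (fun t : ℝ => (4 - t ^ 2) * √(4 - t ^ 2)) (-(3 * t * √(4 - t ^ 2))) t := by
      refine (hu1.mul (hu1.sqrt hu.ne')).congr_deriv ?_
      have hs : √(4 - t ^ 2) ^ 2 = 4 - t ^ 2 := sq_sqrt hu.le
      have hr : 0 < √(4 - t ^ 2) := sqrt_pos.2 hu
      generalize √(4 - t ^ 2) = r at *
      rw [← hs]
      field_simp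
      ring
    refine ((hp.ofReal_comp.mul (hf t ht').hasDerivAt).neg).congr_deriv ?_
    rw [← hfe t ht']
    push_cast
    ring
  · apply Continuous.intervalIntegrable
    fun_prop

theorem integral_sqrt_four_sub_sq : ∫ t in (-2 : ℝ)..2, ((√(4 - t ^ 2) : ℝ) : ℂ) = 2 * π := by
  have h := semicircleMean_eq (fun _ => 1)
  have h2 := sinMoment_sq_mul 0 (F := fun _ => 1) continuous_const
  have h3 := sinMoment_deriv 0 (contDiff_ofReal_mul (contDiff_const (c := (1 : ℂ))))
  have hd : deriv (fun x : ℝ => (x : ℂ) * 1) = fun _ => 1 :=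
    funext fun x => by simpa using (hasDerivAt_ofReal_mul (differentiableAt_const (1 : ℂ))).deriv
  have h0 : sinMoment 0 (fun _ => 1) = π := by simp [sinMoment]
  have hpi : (π : ℂ) ≠ 0 := by exact_mod_cast pi_ne_zero
  rw [hd] at h3
  simp only [semicircleMean, one_mul] at h
  rw [h0] at h2
  have h4 : sinMoment 1 (fun _ => 1) = 2 * π := by
    simp only [zero_add, Nat.cast_zero, mul_zero, one_mul] at h2 h3
    linear_combination (h2 + h3) / 2
  rw [h4] at h
  field_simp at h
  exact h

theorem integral_sub_semicircleMean_mul {g : ℝ → ℂ} (hg : Continuous g) :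
    ∫ t in (-2 : ℝ)..2, (g t - semicircleMean g) * (√(4 - t ^ 2) : ℝ) = 0 := by
  have hpi : (π : ℂ) ≠ 0 := by exact_mod_cast pi_ne_zero
  simp only [sub_mul]
  rw [intervalIntegral.integral_sub, intervalIntegral.integral_const_mul,
    integral_sqrt_four_sub_sq, semicircleMean]
  · field_simp
    ring
  · apply Continuous.intervalIntegrable; fun_prop
  · apply Continuous.intervalIntegrable; fun_prop

/-- The solutions that are smooth at `-2` and at `2` agree on `(-2, 2)`, because `g` minus its mean
integrates to zero against the semicircle density; so they glue to a solution on `ℝ`. -/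
theorem exists_isSolution {g : ℝ → ℂ} (hg : ContDiff ℝ ∞ g) : ∃ f, IsSolution g f := by
  have hh : ContDiff ℝ ∞ (fun t => g t - semicircleMean g) := hg.sub contDiff_const
  obtain ⟨f₁, hf₁, he₁⟩ := exists_solution_Iio hh
  obtain ⟨f₂, hf₂, he₂⟩ := exists_solution_Ioi hh
  have heq : ∀ t ∈ Ioo (-2 : ℝ) 2, f₁ t = f₂ t := by
    intro t ht
    have i₁ := integral_mul_sqrt_eq_of_solution hh.continuous le_rfl ht.1.le ht.2.le
      (fun s hs => (hf₁.differentiableOn (by norm_num)).differentiableAt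
        (Iio_mem_nhds (hs.2.trans_lt ht.2))) (fun s hs => he₁ s (hs.2.trans_lt ht.2))
    have i₂ := integral_mul_sqrt_eq_of_solution hh.continuous ht.1.le ht.2.le le_rfl
      (fun s hs => (hf₂.differentiableOn (by norm_num)).differentiableAt
        (Ioi_mem_nhds (ht.1.trans_le hs.1))) (fun s hs => he₂ s (ht.1.trans_le hs.1))
    have hc : Continuous fun t : ℝ => (g t - semicircleMean g) * (√(4 - t ^ 2) : ℝ) := by
      have := hg.continuous
      fun_prop
    have i := intervalIntegral.integral_add_adjacent_intervals
      (hc.intervalIntegrable (μ := volume) (-2) t) (hc.intervalIntegrable t 2)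
    rw [integral_sub_semicircleMean_mul hg.continuous, i₁, i₂] at i
    have hu : 0 < 4 - t ^ 2 := by nlinarith [ht.1, ht.2]
    have hw : (((4 - t ^ 2) * √(4 - t ^ 2) : ℝ) : ℂ) ≠ 0 := by
      exact_mod_cast (mul_pos hu (sqrt_pos.2 hu)).ne'
    apply mul_left_cancel₀ hw
    norm_num at i
    push_cast
    linear_combination -i
  let f : ℝ → ℂ := fun t => if t < 0 then f₁ t else f₂ t
  have hl : ∀ t < 2, f =ᶠ[nhds t] f₁ := by
    intro t ht
    filter_upwards [Iio_mem_nhds ht] with s hs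
    by_cases h0 : s < 0
    · simp [f, h0]
    · simp only [f, h0, if_false]
      exact (heq s ⟨by linarith, hs⟩).symm
  have hr : ∀ t > -2, f =ᶠ[nhds t] f₂ := by
    intro t ht
    filter_upwards [Ioi_mem_nhds ht] with s hs
    by_cases h0 : s < 0
    · simp only [f, h0, if_true]
      exact heq s ⟨hs, by linarith⟩
    · simp [f, h0]
  refine ⟨f, contDiff_iff_contDiffAt.2 fun t => ?_, fun t => ?_⟩
  · rcases lt_or_ge t 2 with ht | ht
    · exact (hf₁.contDiffAt (Iio_mem_nhds ht)).congr_of_eventuallyEq (hl t ht)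
    · exact (hf₂.contDiffAt (Ioi_mem_nhds (by linarith))).congr_of_eventuallyEq
        (hr t (by linarith))
  · rcases lt_or_ge t 2 with ht | ht
    · rw [(hl t ht).deriv_eq, (hl t ht).eq_of_nhds]
      linear_combination -he₁ t ht
    · rw [(hr t (by linarith)).deriv_eq, (hr t (by linarith)).eq_of_nhds]
      linear_combination -he₂ t (by linarith)

theorem isSolution_S {g : ℝ → ℂ} (hg : ContDiff ℝ ∞ g) : IsSolution g (S g) :=
  Classical.epsilon_spec (exists_isSolution hg)

theorem contDiff_T {g : ℝ → ℂ} (hg : ContDiff ℝ ∞ g) : ContDiff ℝ ∞ (T g) :=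
  contDiff_iteratedDeriv (isSolution_S hg).1 3

/-- The formula for `α_j`. Boundedness of the derivatives of `g` plays no role: the induction only
needs that `T` preserves smoothness. -/
theorem alpha_eq_sum {j : ℕ} (hj : 1 ≤ j) {g : ℝ → ℂ} (hg : ContDiff ℝ ∞ g) :
    alpha j g = ∑ k ∈ Finset.Icc (2 * j) (3 * j - 1), (C j k : ℂ) * normE k g := by
  induction j, hj using Nat.le_induction generalizing g with
  | base =>
    have := (isSolution_S hg).semicircleMean_iteratedDeriv_three hg
    simpa [alpha, C, T] using this
  | succ j hj ih =>
    have h1 : alpha (j + 1) g = alpha j (T g) := by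
      rw [alpha, alpha, Function.iterate_succ_apply]
    rw [h1, ih (contDiff_T hg), ← sum_C_succ hj]
    refine Finset.sum_congr rfl fun k _ => ?_
    rw [T, (isSolution_S hg).normE_iteratedDeriv_three hg]

/-! ### The distribution `α_j` -/

/-- Test functions on `ℝ`. -/
local notation "𝓓ℝ" => 𝓓((⊤ : TopologicalSpace.Opens ℝ), ℂ)

theorem norm_cosIntegral_le (k : ℕ) {h : ℝ → ℂ} {M : ℝ} (hM : ∀ x, ‖h x‖ ≤ M) :
    ‖cosIntegral k h‖ ≤ π * M := by
  have := intervalIntegral.norm_integral_le_of_norm_le_const (a := 0) (b := π) (C := M)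
    (f := fun θ : ℝ => h (2 * cos θ) * ((cos (k * θ) : ℝ) : ℂ)) fun θ _ => by
      rw [norm_mul, Complex.norm_real, Real.norm_eq_abs]
      calc _ ≤ M * 1 := mul_le_mul (hM _) (abs_cos_le_one _) (abs_nonneg _)
            ((norm_nonneg _).trans (hM 0))
        _ = M := mul_one M
  rw [sub_zero, abs_of_pos pi_pos] at this
  rw [mul_comm]
  exact this

theorem norm_normE_le (k : ℕ) {g : ℝ → ℂ} {M : ℝ} (hM : ∀ x, ‖iteratedDeriv k g x‖ ≤ M) :
    ‖normE k g‖ ≤ ‖(k.factorial : ℂ) / ((2 * k).factorial : ℂ)‖ * M := by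
  rw [normE, E_eq_cosIntegral, norm_mul, norm_mul]
  gcongr
  have h1 : ‖1 / (π : ℂ)‖ = 1 / π := by
    rw [norm_div, norm_one, Complex.norm_real, Real.norm_eq_abs, abs_of_pos pi_pos]
  rw [h1]
  calc 1 / π * ‖cosIntegral k (iteratedDeriv k g)‖ ≤ 1 / π * (π * M) := by
        gcongr
        exact norm_cosIntegral_le k hM
    _ = M := by field_simp

/-- `h ↦ ∫_0^π h(2 cos θ) cos (kθ) dθ` as a continuous functional on bounded continuous
functions. -/
noncomputable def cosIntegralCLM (k : ℕ) : BoundedContinuousFunction ℝ ℂ →L[ℂ] ℂ :=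
  LinearMap.mkContinuous
    { toFun := fun h => cosIntegral k h
      map_add' := fun h₁ h₂ => by
        unfold cosIntegral
        rw [← intervalIntegral.integral_add]
        · simp only [BoundedContinuousFunction.coe_add, Pi.add_apply, add_mul]
        · apply Continuous.intervalIntegrable; fun_prop
        · apply Continuous.intervalIntegrable; fun_prop
      map_smul' := fun c h => by
        unfold cosIntegral
        rw [RingHom.id_apply, smul_eq_mul, ← intervalIntegral.integral_const_mul]
        simp only [BoundedContinuousFunction.coe_smul, smul_eq_mul, mul_assoc] } π
    fun h => norm_cosIntegral_le k h.norm_coe_le_norm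

/-- The derivative as a continuous operator on test functions. -/
noncomputable def derivCLM : 𝓓ℝ →L[ℂ] 𝓓ℝ :=
  TestFunction.lineDerivCLM ℂ (1 : ℝ)

theorem derivCLM_apply (φ : 𝓓ℝ) : ⇑(derivCLM φ) = deriv φ := by
  funext x
  rw [derivCLM, TestFunction.lineDerivCLM_apply_of_le (hk := by simp), lineDeriv]
  simp [deriv_comp_const_add]

theorem derivCLM_pow_apply (k : ℕ) (φ : 𝓓ℝ) : ⇑((derivCLM ^ k) φ) = iteratedDeriv k φ := by
  induction k with
  | zero => simp
  | succ k ih =>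
    rw [pow_succ', mul_apply_eq_comp, derivCLM_apply, ih, iteratedDeriv_succ]

/-- The functional `normE k` as a distribution. -/
noncomputable def normECLM (k : ℕ) : 𝓓ℝ →L[ℂ] ℂ :=
  ((k.factorial : ℂ) / ((2 * k).factorial : ℂ) * (1 / (π : ℂ))) •
    (cosIntegralCLM k ∘L TestFunction.toBoundedContinuousFunctionCLM ℂ ∘L derivCLM ^ k)

theorem normECLM_apply (k : ℕ) (φ : 𝓓ℝ) : normECLM k φ = normE k φ := by
  have h : cosIntegralCLM k (TestFunction.toBoundedContinuousFunctionCLM ℂ ((derivCLM ^ k) φ)) =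
      cosIntegral k (iteratedDeriv k φ) := by
    rw [← derivCLM_pow_apply]
    rfl
  rw [normE, E_eq_cosIntegral, ← h, ← mul_assoc]
  rfl

theorem iteratedDeriv_eq_zero_of_disjoint {φ : ℝ → ℂ} {s : Set ℝ} (h : Disjoint (tsupport φ) s)
    (k : ℕ) {x : ℝ} (hx : x ∈ s) : iteratedDeriv k φ x = 0 := by
  have h0 : φ =ᶠ[nhds x] 0 :=
    notMem_tsupport_iff_eventuallyEq.1 fun hx' => disjoint_left.1 h hx' hx
  rw [h0.iteratedDeriv_eq k]
  simp

theorem normE_eq_zero_of_disjoint {φ : ℝ → ℂ} (h : Disjoint (tsupport φ) (Icc (-2 : ℝ) 2))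
    (k : ℕ) : normE k φ = 0 := by
  have h0 : cosIntegral k (iteratedDeriv k φ) = 0 := by
    refine (intervalIntegral.integral_congr (g := fun _ => 0) fun θ _ => ?_).trans (by simp)
    simp only
    rw [iteratedDeriv_eq_zero_of_disjoint h k, zero_mul]
    exact ⟨by linarith [neg_one_le_cos θ], by linarith [cos_le_one θ]⟩
  rw [normE, E_eq_cosIntegral, h0, mul_zero, mul_zero]

theorem norm_iteratedDeriv_le_supNorm (φ : 𝓓ℝ) {i N : ℕ} (hi : i ≤ N) (x : ℝ) :
    ‖iteratedDeriv i φ x‖ ≤ supNorm N φ := by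
  have hb : BddAbove (range fun x => ‖iteratedDeriv i φ x‖) := by
    rw [← derivCLM_pow_apply]
    obtain ⟨M, hM⟩ := ((derivCLM ^ i) φ).continuous.bounded_above_of_compact_support
      ((derivCLM ^ i) φ).hasCompactSupport
    exact ⟨M, by rintro _ ⟨x, rfl⟩; exact hM x⟩
  refine (le_ciSup hb x).trans ?_
  exact le_ciSup (f := fun i : Fin (N + 1) => ⨆ x : ℝ, ‖iteratedDeriv (i : ℕ) φ x‖)
    (finite_range _).bddAbove ⟨i, by omega⟩

end GUE

theorem mainTheorem4 (j : ℕ) (hj : 1 ≤ j) :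
    (∀ g : ℝ → ℂ, GUE.IsCbInfty g →
      GUE.alpha j g =
        ∑ k ∈ Finset.Icc (2 * j) (3 * j - 1),
          (GUE.C j k : ℂ) * ((k.factorial : ℂ) / ((2 * k).factorial : ℂ)) * GUE.E k g) ∧
    ∃ Λ : 𝓓((⊤ : TopologicalSpace.Opens ℝ), ℂ) →L[ℂ] ℂ,
      (∀ φ : 𝓓((⊤ : TopologicalSpace.Opens ℝ), ℂ), Λ φ = GUE.alpha j φ) ∧
      (∀ φ : 𝓓((⊤ : TopologicalSpace.Opens ℝ), ℂ),
        Disjoint (tsupport φ) (Set.Icc (-2 : ℝ) 2) → Λ φ = 0) ∧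
      GUE.HasOrderAtMost Λ (3 * j - 1) := by
  have hΛ (φ : 𝓓((⊤ : TopologicalSpace.Opens ℝ), ℂ)) :
      (∑ k ∈ Finset.Icc (2 * j) (3 * j - 1), (GUE.C j k : ℂ) • GUE.normECLM k) φ =
        ∑ k ∈ Finset.Icc (2 * j) (3 * j - 1), (GUE.C j k : ℂ) * GUE.normE k φ := by
    rw [sum_apply]
    refine Finset.sum_congr rfl fun k _ => ?_
    rw [smul_apply, GUE.normECLM_apply, smul_eq_mul]
  refine ⟨fun g hg => ?_, ∑ k ∈ Finset.Icc (2 * j) (3 * j - 1),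
    (GUE.C j k : ℂ) • GUE.normECLM k, fun φ => ?_, fun φ hφ => ?_, fun K _ => ?_⟩
  · rw [GUE.alpha_eq_sum hj hg.1]
    exact Finset.sum_congr rfl fun k _ => (mul_assoc _ _ _).symm
  · rw [hΛ, GUE.alpha_eq_sum hj φ.contDiff]
  · rw [hΛ]
    exact Finset.sum_eq_zero fun k _ => by rw [GUE.normE_eq_zero_of_disjoint hφ, mul_zero]
  · refine ⟨∑ k ∈ Finset.Icc (2 * j) (3 * j - 1), ‖(GUE.C j k : ℂ)‖ *
      ‖(k.factorial : ℂ) / ((2 * k).factorial : ℂ)‖, fun φ _ => ?_⟩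
    rw [hΛ, Finset.sum_mul]
    refine norm_sum_le_of_le _ fun k hk => ?_
    rw [norm_mul, mul_assoc]
    exact mul_le_mul_of_nonneg_left (GUE.norm_normE_le k fun x =>
      GUE.norm_iteratedDeriv_le_supNorm φ (Finset.mem_Icc.1 hk).2 x) (norm_nonneg _)
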